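/- Let $0\le p,q,\theta<1$ with $\theta$ irrational, and let $N\ge 2$ be an integer. Let $\mathcal O(S^3_{pq\theta})$ be the universal complex unital $*$-algebra generated by $a,b$ subject to $$ab=e^{2\pi i\theta}ba,\quad ab^*=e^{-2\pi i\theta}b^*a,\quad a^*a-p\,aa^*=1-p,\quad b^*b-q\,bb^*=1-q,\quad (1-aa^*)(1-bb^*)=0.$$ Let $\mathcal O(U(1))=\mathbb C[u,u^{-1}]$ and $\mathcal O(\mathbb Z/N\mathbb Z)=\mathbb C[\tilde u]/(\tilde u^N-1)$ be the Hopf algebras with $u$ and $\tilde u$ group-like, and let $\pi:\mathcal O(U(1))\to\mathcal O(\mathbb Z/N\mathbb Z)$ be the Hopf algebra surjection $u\mapsto\tilde u$. Let $\mathcal O(\mathbb Z/N\mathbb Z)$ coact on $\mathcal O(S^3_{pq\theta})$ from the right by the $*$-algebra homomorphism $a\mapsto a\otimes\tilde u$, $b\mapsto b\otimes\tilde u$ (where $\tilde u^*=\tilde u^{-1}$), and on $\mathcal O(U(1))$ from the left by $(\pi\otimes\mathrm{id})\circ\Delta$. The cotensor product $\mathcal O(S^3_{pq\theta})\,\Box_{\mathcal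 O(\mathbb Z/N\mathbb Z)}\,\mathcal O(U(1))\subseteq \mathcal O(S^3_{pq\theta})\otimes\mathcal O(U(1))$, i.e. the subalgebra of those elements on which the two maps to $\mathcal O(S^3_{pq\theta})\otimes\mathcal O(\mathbb Z/N\mathbb Z)\otimes\mathcal O(U(1))$ induced by these coactions agree, is a right $\mathcal O(U(1))$-comodule algebra for the coaction $\mathrm{id}\otimes\Delta$. This comodule algebra is not cleft: there is no unital right $\mathcal O(U(1))$-colinear convolution-invertible linear map $$j:\mathcal O(U(1))\longrightarrow \mathcal O(S^3_{pq\theta})\,\Box_{\mathcal O(\mathbb Z/N\mathbb Z)}\,\mathcal O(U(1)).$$ -/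

import Mathlib

open scoped TensorProduct

noncomputable section

namespace HeegaardSphere

universe u v w x

/-! ### Comodule algebras, cleft comodule algebras -/

section General

variable (k : Type u) [Field k]

/-- The structure of a right `H`-comodule algebra on a unital associative algebra `P`: a
coassociative counital coaction `P → P ⊗ H` that is a homomorphism of unital algebras. -/
structure RightComoduleAlgebra (H : Type v) [Ring H] [HopfAlgebra k H]
    (P : Type w) [Ring P] [Algebra k P] where
  coact : P →ₐ[k] P ⊗[k] H
  coact_coassoc :
    (TensorProduct.assoc k P H H).toLinearMap ∘ₗ coact.toLinearMap.rTensor H ∘ₗ coact.toLinearMap =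
      (Coalgebra.comul (R := k) (A := H)).lTensor P ∘ₗ coact.toLinearMap
  coact_counit :
    (TensorProduct.rid k P).toLinearMap ∘ₗ (Coalgebra.counit (R := k) (A := H)).lTensor P ∘ₗ
      coact.toLinearMap = LinearMap.id

variable {k}
variable {H : Type v} [Ring H] [HopfAlgebra k H] {P : Type w} [Ring P] [Algebra k P]
  {V : Type x} [Ring V] [HopfAlgebra k V]

/-- A cleaving map: a unital right `H`-colinear linear map `j : H → P` which is invertible for the
convolution product `(f * g)(h) = f(h₁) g(h₂)` (the ring structure of `WithConv (H →ₗ[k] P)`,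
whose unit is `h ↦ ε(h) 1`). -/
structure RightComoduleAlgebra.IsCleavingMap (ρ : RightComoduleAlgebra k H P)
    (j : H →ₗ[k] P) : Prop where
  unital : j 1 = 1
  colinear : ρ.coact.toLinearMap ∘ₗ j = j.rTensor H ∘ₗ Coalgebra.comul (R := k) (A := H)
  convInvertible : IsUnit (WithConv.toConv j)

/-- A comodule algebra is cleft if it admits a cleaving map. -/
def RightComoduleAlgebra.IsCleft (ρ : RightComoduleAlgebra k H P) : Prop :=
  ∃ j : H →ₗ[k] P, ρ.IsCleavingMap j

/-! ### Cotensor products and prolongations -/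

/-- The cotensor product `M □_C N ⊆ M ⊗ N` of a right coaction `δ : M → M ⊗ C` and a left
coaction `γ : N → C ⊗ N`. -/
def cotensorProduct {C M N : Type*} [AddCommGroup C] [Module k C] [AddCommGroup M] [Module k M]
    [AddCommGroup N] [Module k N] (δ : M →ₗ[k] M ⊗[k] C) (γ : N →ₗ[k] C ⊗[k] N) :
    Submodule k (M ⊗[k] N) :=
  LinearMap.eqLocus ((TensorProduct.assoc k M C N).toLinearMap ∘ₗ δ.rTensor N) (γ.lTensor M)

/-- The left `H`-coaction `(π ⊗ id) ∘ Δ` on `V` induced by a Hopf algebra map `π : V → H`. -/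
def leftCoact (π : V →ₐc[k] H) : V →ₐ[k] H ⊗[k] V :=
  (Algebra.TensorProduct.map (π : V →ₐ[k] H) (AlgHom.id k V)).comp (Bialgebra.comulAlgHom k V)

/-- Changing the structure Hopf algebra of a comodule algebra along a Hopf algebra map
`π : V → H`: the coaction `(id ⊗ π) ∘ Δ_P`. -/
def RightComoduleAlgebra.pushforward (ρ : RightComoduleAlgebra k V P) (π : V →ₐc[k] H) :
    RightComoduleAlgebra k H P where
  coact := (Algebra.TensorProduct.map (AlgHom.id k P) (π : V →ₐ[k] H)).comp ρ.coact
  coact_coassoc := by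
    set f : P ⊗[k] V →ₗ[k] P ⊗[k] H := (π : V →ₗ[k] H).lTensor P with hf
    have hc : ((Algebra.TensorProduct.map (AlgHom.id k P) (π : V →ₐ[k] H)).comp
        ρ.coact).toLinearMap = f ∘ₗ ρ.coact.toLinearMap := by
      ext p; rfl
    rw [hc]
    have hπ : (Coalgebra.comul (R := k) (A := H)) ∘ₗ (π : V →ₗ[k] H)
        = TensorProduct.map (π : V →ₗ[k] H) (π : V →ₗ[k] H) ∘ₗ Coalgebra.comul :=
      (CoalgHomClass.map_comp_comul π).symm
    have h1 : (TensorProduct.assoc k P H H).toLinearMap ∘ₗ (f ∘ₗ ρ.coact.toLinearMap).rTensor H ∘ₗ f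
        = (TensorProduct.map (π : V →ₗ[k] H) (π : V →ₗ[k] H)).lTensor P ∘ₗ
          (TensorProduct.assoc k P V V).toLinearMap ∘ₗ ρ.coact.toLinearMap.rTensor V := by
      refine TensorProduct.ext' fun p v => ?_
      simp only [LinearMap.comp_apply, hf, LinearMap.lTensor_tmul, LinearMap.rTensor_tmul]
      induction ρ.coact.toLinearMap p using TensorProduct.induction_on with
      | zero => simp
      | tmul x y => simp
      | add x y hx hy => simp only [TensorProduct.add_tmul, map_add, hx, hy]
    calc _ = ((TensorProduct.assoc k P H H).toLinearMap ∘ₗ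
          (f ∘ₗ ρ.coact.toLinearMap).rTensor H ∘ₗ f) ∘ₗ ρ.coact.toLinearMap := rfl
      _ = (TensorProduct.map (π : V →ₗ[k] H) (π : V →ₗ[k] H)).lTensor P ∘ₗ
          ((TensorProduct.assoc k P V V).toLinearMap ∘ₗ ρ.coact.toLinearMap.rTensor V ∘ₗ
            ρ.coact.toLinearMap) := by rw [h1]; rfl
      _ = _ := by
        rw [ρ.coact_coassoc, ← LinearMap.comp_assoc, ← LinearMap.lTensor_comp, ← hπ,
          LinearMap.lTensor_comp, LinearMap.comp_assoc]
  coact_counit := by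
    have hπ : (Coalgebra.counit (R := k) (A := H)) ∘ₗ (π : V →ₗ[k] H) = Coalgebra.counit :=
      CoalgHomClass.counit_comp π
    have hc : ((Algebra.TensorProduct.map (AlgHom.id k P) (π : V →ₐ[k] H)).comp
        ρ.coact).toLinearMap = (π : V →ₗ[k] H).lTensor P ∘ₗ ρ.coact.toLinearMap := by
      ext p; rfl
    rw [hc, ← LinearMap.comp_assoc _ _ (Coalgebra.counit.lTensor P), ← LinearMap.lTensor_comp, hπ]
    exact ρ.coact_counit

/-- The cotensor product `P □_H V` of a comodule algebra `P` with `V` as a subalgebra of `P ⊗ V`. -/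
def prolongationSubalgebra (ρ : RightComoduleAlgebra k H P) (π : V →ₐc[k] H) :
    Subalgebra k (P ⊗[k] V) :=
  (cotensorProduct ρ.coact.toLinearMap (leftCoact π).toLinearMap).toSubalgebra
    (AlgHom.equalizer
      (((Algebra.TensorProduct.assoc k k k P H V : (P ⊗[k] H) ⊗[k] V →ₐ[k] P ⊗[k] (H ⊗[k] V))).comp
        (Algebra.TensorProduct.map ρ.coact (AlgHom.id k V)))
      (Algebra.TensorProduct.map (AlgHom.id k P) (leftCoact π))).one_mem
    (fun _ _ hs ht => (AlgHom.equalizer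
      (((Algebra.TensorProduct.assoc k k k P H V : (P ⊗[k] H) ⊗[k] V →ₐ[k] P ⊗[k] (H ⊗[k] V))).comp
        (Algebra.TensorProduct.map ρ.coact (AlgHom.id k V)))
      (Algebra.TensorProduct.map (AlgHom.id k P) (leftCoact π))).mul_mem hs ht)

/-- The coaction `id ⊗ Δ : P ⊗ V → P ⊗ V ⊗ V`. -/
def tensorCoact (k : Type u) [Field k] (P : Type w) [Ring P] [Algebra k P]
    (V : Type x) [Ring V] [HopfAlgebra k V] : P ⊗[k] V →ₐ[k] (P ⊗[k] V) ⊗[k] V :=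
  ((Algebra.TensorProduct.assoc k k k P V V).symm : P ⊗[k] (V ⊗[k] V) →ₐ[k] (P ⊗[k] V) ⊗[k] V).comp
    (Algebra.TensorProduct.map (AlgHom.id k P) (Bialgebra.comulAlgHom k V))

theorem tensorCoact_tmul (p : P) (v : V) : tensorCoact k P V (p ⊗ₜ v) =
    (TensorProduct.assoc k P V V).symm (p ⊗ₜ Coalgebra.comul v) := rfl

theorem tensorCoact_coassoc :
    (TensorProduct.assoc k (P ⊗[k] V) V V).toLinearMap ∘ₗ
      (tensorCoact k P V).toLinearMap.rTensor V ∘ₗ (tensorCoact k P V).toLinearMap =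
    (Coalgebra.comul (R := k) (A := V)).lTensor (P ⊗[k] V) ∘ₗ
      (tensorCoact k P V).toLinearMap := by
  refine TensorProduct.ext' fun p v => ?_
  have h := Coalgebra.coassoc_apply (R := k) v
  have h1 : ∀ t : V ⊗[k] V, (TensorProduct.assoc k (P ⊗[k] V) V V)
      ((tensorCoact k P V).toLinearMap.rTensor V ((TensorProduct.assoc k P V V).symm (p ⊗ₜ t))) =
      (TensorProduct.assoc k P V (V ⊗[k] V)).symm (p ⊗ₜ
        TensorProduct.assoc k V V V (Coalgebra.comul.rTensor V t)) := by
    intro t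
    induction t using TensorProduct.induction_on with
    | zero => simp
    | add x y hx hy => simp only [TensorProduct.tmul_add, map_add, hx, hy]
    | tmul x y =>
      simp only [TensorProduct.assoc_symm_tmul, LinearMap.rTensor_tmul, AlgHom.toLinearMap_apply,
        tensorCoact_tmul]
      induction (Coalgebra.comul (R := k) x) using TensorProduct.induction_on with
      | zero => simp
      | add x y hx hy => simp only [TensorProduct.tmul_add, TensorProduct.add_tmul, map_add, hx, hy]
      | tmul x y => simp
  have h2 : ∀ t : V ⊗[k] V, (Coalgebra.comul (R := k) (A := V)).lTensor (P ⊗[k] V)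
      ((TensorProduct.assoc k P V V).symm (p ⊗ₜ t)) =
      (TensorProduct.assoc k P V (V ⊗[k] V)).symm (p ⊗ₜ Coalgebra.comul.lTensor V t) := by
    intro t
    induction t using TensorProduct.induction_on with
    | zero => simp
    | add x y hx hy => simp only [TensorProduct.tmul_add, map_add, hx, hy]
    | tmul x y => simp
  simp only [LinearMap.comp_apply, AlgHom.toLinearMap_apply, tensorCoact_tmul,
    LinearEquiv.coe_coe, h1, h2, h]

theorem tensorCoact_counit :
    (TensorProduct.rid k (P ⊗[k] V)).toLinearMap ∘ₗ
      (Coalgebra.counit (R := k) (A := V)).lTensor (P ⊗[k] V) ∘ₗ (tensorCoact k P V).toLinearMap =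
    LinearMap.id := by
  refine TensorProduct.ext' fun p v => ?_
  have h := Coalgebra.lTensor_counit_comul (R := k) v
  have h1 : ∀ t : V ⊗[k] V, (TensorProduct.rid k (P ⊗[k] V))
      ((Coalgebra.counit (R := k) (A := V)).lTensor (P ⊗[k] V)
        ((TensorProduct.assoc k P V V).symm (p ⊗ₜ t))) =
      p ⊗ₜ TensorProduct.rid k V (Coalgebra.counit.lTensor V t) := by
    intro t
    induction t using TensorProduct.induction_on with
    | zero => simp
    | add x y hx hy => simp only [TensorProduct.tmul_add, map_add, hx, hy]
    | tmul x y => simp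
  simp only [LinearMap.comp_apply, AlgHom.toLinearMap_apply, tensorCoact_tmul,
    LinearEquiv.coe_coe, h1, h]
  simp

/-- The inclusion `(P □_H V) ⊗ V → (P ⊗ V) ⊗ V`. -/
def prolongationIncl (ρ : RightComoduleAlgebra k H P) (π : V →ₐc[k] H) :
    prolongationSubalgebra ρ π ⊗[k] V →ₐ[k] (P ⊗[k] V) ⊗[k] V :=
  Algebra.TensorProduct.map (prolongationSubalgebra ρ π).val (AlgHom.id k V)

theorem prolongationIncl_injective (ρ : RightComoduleAlgebra k H P) (π : V →ₐc[k] H) :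
    Function.Injective (prolongationIncl ρ π) :=
  Module.Flat.rTensor_preserves_injective_linearMap (M := V)
    (prolongationSubalgebra ρ π).val.toLinearMap Subtype.val_injective

theorem leftCoact_coassoc (π : V →ₐc[k] H) (v : V) :
    (leftCoact π).toLinearMap.rTensor V (Coalgebra.comul (R := k) v) =
      (TensorProduct.assoc k H V V).symm (Coalgebra.comul.lTensor H (leftCoact π v)) := by
  have h := Coalgebra.coassoc_symm_apply (R := k) v
  have h1 : ∀ t : V ⊗[k] V, (leftCoact π).toLinearMap.rTensor V t =
      ((π : V →ₗ[k] H).rTensor V).rTensor V (Coalgebra.comul.rTensor V t) := by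
    intro t
    induction t using TensorProduct.induction_on with
    | zero => simp
    | add x y hx hy => simp only [map_add, hx, hy]
    | tmul x y => rfl
  have h2 : ∀ t : V ⊗[k] V, (TensorProduct.assoc k H V V).symm (Coalgebra.comul.lTensor H
        ((π : V →ₗ[k] H).rTensor V t)) =
      ((π : V →ₗ[k] H).rTensor V).rTensor V ((TensorProduct.assoc k V V V).symm
        (Coalgebra.comul.lTensor V t)) := by
    intro t
    induction t using TensorProduct.induction_on with
    | zero => simp
    | add x y hx hy => simp only [map_add, hx, hy]
    | tmul x y =>
      simp only [LinearMap.rTensor_tmul, LinearMap.lTensor_tmul]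
      induction (Coalgebra.comul (R := k) y) using TensorProduct.induction_on with
      | zero => simp
      | add x y hx hy => simp only [TensorProduct.tmul_add, map_add, hx, hy]
      | tmul x y => simp
  rw [h1, ← h, ← h2]
  rfl

theorem tensorCoact_mem_range (ρ : RightComoduleAlgebra k H P) (π : V →ₐc[k] H)
    (t : prolongationSubalgebra ρ π) :
    tensorCoact k P V t ∈ (prolongationIncl ρ π).range := by
  set f : P ⊗[k] V →ₗ[k] P ⊗[k] (H ⊗[k] V) :=
    (TensorProduct.assoc k P H V).toLinearMap ∘ₗ ρ.coact.toLinearMap.rTensor V with hf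
  set g : P ⊗[k] V →ₗ[k] P ⊗[k] (H ⊗[k] V) := (leftCoact π).toLinearMap.lTensor P with hg
  let L : P ⊗[k] (H ⊗[k] V) →ₗ[k] (P ⊗[k] (H ⊗[k] V)) ⊗[k] V :=
    (TensorProduct.assoc k P (H ⊗[k] V) V).symm.toLinearMap ∘ₗ
      ((TensorProduct.assoc k H V V).symm.toLinearMap ∘ₗ
        (Coalgebra.comul (R := k) (A := V)).lTensor H).lTensor P
  have hfL : f.rTensor V ∘ₗ (tensorCoact k P V).toLinearMap = L ∘ₗ f := by
    refine TensorProduct.ext' fun p v => ?_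
    simp only [LinearMap.comp_apply, AlgHom.toLinearMap_apply, tensorCoact_tmul, hf,
      LinearMap.rTensor_tmul, LinearEquiv.coe_coe]
    have h1 : ∀ w : V ⊗[k] V, f.rTensor V ((TensorProduct.assoc k P V V).symm (p ⊗ₜ w)) =
        (TensorProduct.assoc k P (H ⊗[k] V) V).symm
          (((TensorProduct.assoc k H V V).symm.toLinearMap).lTensor P
            (TensorProduct.assoc k P H (V ⊗[k] V) (ρ.coact p ⊗ₜ w))) := by
      intro w
      induction w using TensorProduct.induction_on with
      | zero => simp
      | add x y hx hy => simp only [TensorProduct.tmul_add, map_add, hx, hy]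
      | tmul x y =>
        simp only [TensorProduct.assoc_symm_tmul, LinearMap.rTensor_tmul, hf,
          LinearMap.comp_apply, AlgHom.toLinearMap_apply, LinearEquiv.coe_coe]
        induction ρ.coact p using TensorProduct.induction_on with
        | zero => simp
        | add x y hx hy => simp only [TensorProduct.add_tmul, map_add, hx, hy]
        | tmul x y => simp
    rw [← hf, h1]
    induction ρ.coact p using TensorProduct.induction_on with
    | zero => simp
    | add x y hx hy => simp only [TensorProduct.add_tmul, map_add, hx, hy]
    | tmul x y => simp [L]
  have hgL : g.rTensor V ∘ₗ (tensorCoact k P V).toLinearMap = L ∘ₗ g := by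
    refine TensorProduct.ext' fun p v => ?_
    have h1 : ∀ w : V ⊗[k] V, g.rTensor V ((TensorProduct.assoc k P V V).symm (p ⊗ₜ w)) =
        (TensorProduct.assoc k P (H ⊗[k] V) V).symm
          (p ⊗ₜ (leftCoact π).toLinearMap.rTensor V w) := by
      intro w
      induction w using TensorProduct.induction_on with
      | zero => simp
      | add x y hx hy => simp only [TensorProduct.tmul_add, map_add, hx, hy]
      | tmul x y => simp [hg]
    simp only [LinearMap.comp_apply, AlgHom.toLinearMap_apply, tensorCoact_tmul, h1,
      leftCoact_coassoc]
    rfl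
  have ht : f (t : P ⊗[k] V) = g (t : P ⊗[k] V) := t.2
  have h0 : (f - g).rTensor V (tensorCoact k P V t) = 0 := by
    have e1 := LinearMap.congr_fun hfL (t : P ⊗[k] V)
    have e2 := LinearMap.congr_fun hgL (t : P ⊗[k] V)
    simp only [LinearMap.comp_apply, AlgHom.toLinearMap_apply] at e1 e2
    rw [LinearMap.rTensor_sub]
    change f.rTensor V _ - g.rTensor V _ = 0
    rw [e1, e2, ht, sub_self]
  obtain ⟨y, hy⟩ := (Module.Flat.rTensor_exact V (LinearMap.exact_subtype_ker_map (f - g)) _).1 h0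
  let i : LinearMap.ker (f - g) →ₗ[k] prolongationSubalgebra ρ π :=
    LinearMap.codRestrict (Subalgebra.toSubmodule (prolongationSubalgebra ρ π))
      (LinearMap.ker (f - g)).subtype (fun x => sub_eq_zero.1 x.2)
  refine ⟨i.rTensor V y, ?_⟩
  rw [← hy]
  change (prolongationSubalgebra ρ π).val.toLinearMap.rTensor V (i.rTensor V y) = _
  rw [← LinearMap.comp_apply, ← LinearMap.rTensor_comp]
  rfl

/-- The coaction `id ⊗ Δ` of `V` on `P □_H V`. -/
def prolongationCoact (ρ : RightComoduleAlgebra k H P) (π : V →ₐc[k] H) :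
    prolongationSubalgebra ρ π →ₐ[k] prolongationSubalgebra ρ π ⊗[k] V :=
  ((AlgEquiv.ofInjective (prolongationIncl ρ π) (prolongationIncl_injective ρ π)).symm :
      (prolongationIncl ρ π).range →ₐ[k] prolongationSubalgebra ρ π ⊗[k] V).comp
    (((tensorCoact k P V).comp (prolongationSubalgebra ρ π).val).codRestrict
      (prolongationIncl ρ π).range (tensorCoact_mem_range ρ π))

/-- The defining property of the coaction on `P □_H V`: it is the restriction of `id ⊗ Δ`. -/
theorem prolongationIncl_coact (ρ : RightComoduleAlgebra k H P) (π : V →ₐc[k] H)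
    (t : prolongationSubalgebra ρ π) :
    prolongationIncl ρ π (prolongationCoact ρ π t) = tensorCoact k P V t := by
  have := (AlgEquiv.ofInjective (prolongationIncl ρ π) (prolongationIncl_injective ρ π)
    ).apply_symm_apply ⟨tensorCoact k P V t, tensorCoact_mem_range ρ π t⟩
  exact congrArg Subtype.val this

/-- The `V`-prolongation of an `H`-comodule algebra `P` along a Hopf algebra map `π : V → H`: the
`V`-comodule algebra `P □_H V` with coaction `id ⊗ Δ`. -/
def prolongation (ρ : RightComoduleAlgebra k H P) (π : V →ₐc[k] H) :
    RightComoduleAlgebra k V (prolongationSubalgebra ρ π) where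
  coact := prolongationCoact ρ π
  coact_coassoc := by
    let S := prolongationSubalgebra ρ π
    let D : S →ₗ[k] S ⊗[k] V := (prolongationCoact ρ π).toLinearMap
    let δ := (tensorCoact k P V).toLinearMap
    let i : S →ₗ[k] P ⊗[k] V := S.val.toLinearMap
    have hi_inj : Function.Injective (i.rTensor (V ⊗[k] V)) :=
      Module.Flat.rTensor_preserves_injective_linearMap i Subtype.val_injective
    have h : i.rTensor V ∘ₗ D = δ ∘ₗ i := by
      ext t
      exact prolongationIncl_coact ρ π t
    have h1 : i.rTensor (V ⊗[k] V) ∘ₗ (TensorProduct.assoc k S V V).toLinearMap =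
        (TensorProduct.assoc k (P ⊗[k] V) V V).toLinearMap ∘ₗ (i.rTensor V).rTensor V := by
      refine TensorProduct.ext_threefold fun x y z => ?_
      simp
    have h2 : i.rTensor (V ⊗[k] V) ∘ₗ (Coalgebra.comul (R := k) (A := V)).lTensor S =
        (Coalgebra.comul (R := k) (A := V)).lTensor (P ⊗[k] V) ∘ₗ i.rTensor V := by
      refine TensorProduct.ext' fun x y => ?_
      simp
    have h3 : (i.rTensor V).rTensor V ∘ₗ D.rTensor V = δ.rTensor V ∘ₗ i.rTensor V := by
      rw [← LinearMap.rTensor_comp, h, LinearMap.rTensor_comp]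
    refine LinearMap.ext fun t => hi_inj ?_
    have e (t : S) : i.rTensor V (D t) = δ (i t) := LinearMap.congr_fun h t
    calc i.rTensor (V ⊗[k] V) (TensorProduct.assoc k S V V (D.rTensor V (D t)))
        = TensorProduct.assoc k (P ⊗[k] V) V V ((i.rTensor V).rTensor V (D.rTensor V (D t))) :=
          LinearMap.congr_fun h1 _
      _ = TensorProduct.assoc k (P ⊗[k] V) V V (δ.rTensor V (i.rTensor V (D t))) :=
          congrArg _ (LinearMap.congr_fun h3 _)
      _ = TensorProduct.assoc k (P ⊗[k] V) V V (δ.rTensor V (δ (i t))) := by rw [e]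
      _ = (Coalgebra.comul (R := k) (A := V)).lTensor (P ⊗[k] V) (δ (i t)) :=
          LinearMap.congr_fun tensorCoact_coassoc (i t)
      _ = (Coalgebra.comul (R := k) (A := V)).lTensor (P ⊗[k] V) (i.rTensor V (D t)) := by rw [e]
      _ = i.rTensor (V ⊗[k] V) ((Coalgebra.comul (R := k) (A := V)).lTensor S (D t)) :=
          (LinearMap.congr_fun h2 _).symm
  coact_counit := by
    let S := prolongationSubalgebra ρ π
    let D : S →ₗ[k] S ⊗[k] V := (prolongationCoact ρ π).toLinearMap
    let δ := (tensorCoact k P V).toLinearMap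
    let i : S →ₗ[k] P ⊗[k] V := S.val.toLinearMap
    have h1 : i ∘ₗ (TensorProduct.rid k S).toLinearMap ∘ₗ
        (Coalgebra.counit (R := k) (A := V)).lTensor S =
        (TensorProduct.rid k (P ⊗[k] V)).toLinearMap ∘ₗ
          (Coalgebra.counit (R := k) (A := V)).lTensor (P ⊗[k] V) ∘ₗ i.rTensor V := by
      refine TensorProduct.ext' fun x y => ?_
      simp
    refine LinearMap.ext fun t => Subtype.val_injective ?_
    have e : i.rTensor V (D t) = δ (i t) := prolongationIncl_coact ρ π t
    calc i (TensorProduct.rid k S ((Coalgebra.counit (R := k) (A := V)).lTensor S (D t)))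
        = TensorProduct.rid k (P ⊗[k] V)
            ((Coalgebra.counit (R := k) (A := V)).lTensor (P ⊗[k] V) (i.rTensor V (D t))) :=
          LinearMap.congr_fun h1 _
      _ = i t := by
          rw [e]
          exact LinearMap.congr_fun tensorCoact_counit (i t)

end General

/-! ### The coordinate algebras -/

/-- The Hopf algebra `O(U(1)) = ℂ[u, u⁻¹]`, with `u = T 1` group-like. -/
abbrev OU1 : Type := LaurentPolynomial ℂ

/-- The Hopf algebra `O(ℤ/Nℤ)`, generated by a group-like `ũ` with `ũ ^ N = 1`: the group algebra
of the cyclic group of order `N`. -/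
abbrev OZMod (N : ℕ) : Type := AddMonoidAlgebra ℂ (ZMod N)

/-- The Hopf algebra surjection `π : O(U(1)) → O(ℤ/Nℤ)`, `u ↦ ũ`. -/
def projZMod (N : ℕ) : OU1 →ₐc[ℂ] OZMod N :=
  AddMonoidAlgebra.mapDomainBialgHom ℂ (Int.castAddHom (ZMod N))

theorem projZMod_T (N : ℕ) (n : ℤ) :
    projZMod N (LaurentPolynomial.T n) = AddMonoidAlgebra.single (n : ZMod N) 1 :=
  AddMonoidAlgebra.mapDomainBialgHom_single _ _ _

/-- The generators `a, a*, b, b*`. -/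
inductive Gen : Type
  | a | aStar | b | bStar

/-- The letters of the free algebra on `a, a*, b, b*`. -/
def letter (g : Gen) : FreeAlgebra ℂ Gen := FreeAlgebra.ι ℂ g

/-- The phase `exp(2πiθ)`. -/
def phase (θ : ℝ) : ℂ := Complex.exp (2 * Real.pi * Complex.I * θ)

open Gen in
/-- The defining relations of the Heegaard quantum sphere together with their adjoints (the two
disc relations are self-adjoint, as `p` and `q` are real). -/
inductive SphereRel (p q θ : ℝ) : FreeAlgebra ℂ Gen → FreeAlgebra ℂ Gen → Prop
  | ab : SphereRel p q θ (letter a * letter b) (phase θ • (letter b * letter a))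
  | ab_adj : SphereRel p q θ (letter bStar * letter aStar)
      (phase (-θ) • (letter aStar * letter bStar))
  | abStar : SphereRel p q θ (letter a * letter bStar) (phase (-θ) • (letter bStar * letter a))
  | abStar_adj : SphereRel p q θ (letter b * letter aStar) (phase θ • (letter aStar * letter b))
  | disc_a : SphereRel p q θ (letter aStar * letter a - (p : ℂ) • (letter a * letter aStar))
      (algebraMap ℂ _ (1 - p))
  | disc_b : SphereRel p q θ (letter bStar * letter b - (q : ℂ) • (letter b * letter bStar))
      (algebraMap ℂ _ (1 - q))
  | sphere : SphereRel p q θ ((1 - letter a * letter aStar) * (1 - letter b * letter bStar)) 0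
  | sphere_adj : SphereRel p q θ ((1 - letter b * letter bStar) * (1 - letter a * letter aStar)) 0

/-- The coordinate algebra `O(S³_{pqθ})`: the underlying algebra of the universal `*`-algebra
generated by `a` and `b` subject to the relations, i.e. the free algebra on `a, a*, b, b*` modulo
the relations and their adjoints. -/
abbrev OSphere (p q θ : ℝ) : Type := RingQuot (SphereRel p q θ)

section Sphere

variable (p q θ : ℝ)

/-- The image of a generator in `O(S³_{pqθ})`. -/
def gen (g : Gen) : OSphere p q θ := RingQuot.mkAlgHom ℂ (SphereRel p q θ) (letter g)

/-- The degree of the generators: `1` on `a, b` and `-1` on `a*, b*`. -/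
def Gen.deg : Gen → ℤ
  | .a => 1
  | .aStar => -1
  | .b => 1
  | .bStar => -1

theorem gen_rel {x y : FreeAlgebra ℂ Gen} (h : SphereRel p q θ x y) :
    FreeAlgebra.lift ℂ (gen p q θ) x = FreeAlgebra.lift ℂ (gen p q θ) y := by
  have : FreeAlgebra.lift ℂ (gen p q θ) = RingQuot.mkAlgHom ℂ (SphereRel p q θ) := by
    ext g
    simp [gen, letter]
  rw [this]
  exact RingQuot.mkAlgHom_rel ℂ h

theorem sphereCoact_rel ⦃x y : FreeAlgebra ℂ Gen⦄ (h : SphereRel p q θ x y) :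
    FreeAlgebra.lift ℂ (fun g => gen p q θ g ⊗ₜ[ℂ] (LaurentPolynomial.T g.deg : OU1)) x =
      FreeAlgebra.lift ℂ (fun g => gen p q θ g ⊗ₜ[ℂ] (LaurentPolynomial.T g.deg : OU1)) y := by
  have hr := gen_rel p q θ h
  have hr' := congrArg (Algebra.TensorProduct.includeLeft :
    OSphere p q θ →ₐ[ℂ] OSphere p q θ ⊗[ℂ] OU1) hr
  cases h
  case ab | ab_adj =>
    simp only [letter, map_mul, map_smul, FreeAlgebra.lift_ι_apply, Gen.deg,
      Algebra.TensorProduct.tmul_mul_tmul, ← LaurentPolynomial.T_add,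
      TensorProduct.smul_tmul'] at hr ⊢
    rw [hr]
  all_goals
    simpa only [letter, map_mul, map_sub, map_smul, map_one, map_zero, FreeAlgebra.lift_ι_apply,
      AlgHom.commutes, Algebra.TensorProduct.tmul_mul_tmul, ← LaurentPolynomial.T_add, Gen.deg,
      Algebra.TensorProduct.includeLeft_apply, Int.reduceAdd, Int.reduceNeg, mul_one,
      LaurentPolynomial.T_zero] using hr'

/-- The `O(U(1))`-coaction on `O(S³_{pqθ})` given by `a ↦ a ⊗ u`, `b ↦ b ⊗ u` (hence
`a* ↦ a* ⊗ u⁻¹`, `b* ↦ b* ⊗ u⁻¹`). -/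
def sphereCoact : OSphere p q θ →ₐ[ℂ] OSphere p q θ ⊗[ℂ] OU1 :=
  RingQuot.liftAlgHom ℂ ⟨FreeAlgebra.lift ℂ fun g => gen p q θ g ⊗ₜ LaurentPolynomial.T g.deg,
    sphereCoact_rel p q θ⟩

theorem sphereCoact_gen (g : Gen) :
    sphereCoact p q θ (gen p q θ g) = gen p q θ g ⊗ₜ LaurentPolynomial.T g.deg := by
  simp [sphereCoact, gen, letter]

/-- `O(S³_{pqθ})` as an `O(U(1))`-comodule algebra. -/
def sphereU1 : RightComoduleAlgebra ℂ OU1 (OSphere p q θ) where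
  coact := sphereCoact p q θ
  coact_coassoc := by
    have h : ((Algebra.TensorProduct.assoc ℂ ℂ ℂ (OSphere p q θ) OU1 OU1).toAlgHom.comp
        ((Algebra.TensorProduct.map (sphereCoact p q θ) (AlgHom.id ℂ OU1)).comp
          (sphereCoact p q θ))) =
        (Algebra.TensorProduct.map (AlgHom.id ℂ _) (Bialgebra.comulAlgHom ℂ OU1)).comp
          (sphereCoact p q θ) := by
      refine RingQuot.ringQuot_ext' _ _ _ (FreeAlgebra.hom_ext (funext fun g => ?_))
      have := sphereCoact_gen p q θ g
      simp only [gen, letter] at this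
      simp [this]
    exact congrArg AlgHom.toLinearMap h
  coact_counit := by
    have h : (Algebra.TensorProduct.rid ℂ ℂ (OSphere p q θ)).toAlgHom.comp
        ((Algebra.TensorProduct.map (AlgHom.id ℂ _) (Bialgebra.counitAlgHom ℂ OU1)).comp
          (sphereCoact p q θ)) = AlgHom.id ℂ _ := by
      refine RingQuot.ringQuot_ext' _ _ _ (FreeAlgebra.hom_ext (funext fun g => ?_))
      have := sphereCoact_gen p q θ g
      simp only [gen, letter] at this
      simp [this]
    exact congrArg AlgHom.toLinearMap h

/-- `O(S³_{pqθ})` as an `O(ℤ/Nℤ)`-comodule algebra, via `π`. -/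
def sphereZMod (N : ℕ) : RightComoduleAlgebra ℂ (OZMod N) (OSphere p q θ) :=
  (sphereU1 p q θ).pushforward (projZMod N)

/-- The `O(U(1))`-comodule algebra `O(S³_{pqθ}) □_{O(ℤ/Nℤ)} O(U(1))`. -/
def sphereProlongation (N : ℕ) :
    RightComoduleAlgebra ℂ OU1 (prolongationSubalgebra (sphereZMod p q θ N) (projZMod N)) :=
  prolongation (sphereZMod p q θ N) (projZMod N)

end Sphere

end HeegaardSphere

end

/-! A colinear `j` must send the group-like `u` to `x ⊗ u`, and convolution-invertibility makes `x`
a unit of `O(S³_{pqθ})`. Membership in the cotensor product then forces `x` to have degree `1`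
modulo `N`: the automorphism scaling `a, b` by a primitive `N`-th root of unity `ζ` multiplies `x`
by `ζ`. It remains to see that units have degree zero.

Map the sphere algebra to the quantum torus, where `a` and `b` are both invertible. Units there are
monomials, because `ℤ²` has two unique sums (`exists_torusRep_eq_single`), so `x` has symbol `c aᵐ
bⁿ`. The exponents are winding numbers, and an index argument kills them. On the half line with `a`
as shift, `x` acts as an invertible banded operator asymptotic to a weighted bilateral shift of
length `m`. Its index is therefore both `0` and `-m`, so `m = 0`; exchanging `a` and `b` gives `n =
0`.

The index is handled algebraically. For commuting `X, Y`, the truncated trace of `XY - YX` reduces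
to a finite corner sum which vanishes (`corner_sum_eq_zero`), while its limit depends only on the
symbols and counts `m` (`not_isToeplitz_of_pos_shift`). Hence the symbol of `x` is a nonzero
constant, fixed by the scaling, and `ζ = 1`, against `N ≥ 2`. -/

namespace HeegaardSphere

open Finsupp Filter Topology

/-! ### Weighted shifts and matrix entries -/

section Entries

variable {I J : Type*}

/-- The linear map `e_k ↦ c k • e_{f k}`. -/
noncomputable def weightedShift (f : I → J) (c : I → ℂ) : (I →₀ ℂ) →ₗ[ℂ] (J →₀ ℂ) :=
  Finsupp.linearCombination ℂ fun k => single (f k) (c k)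

theorem weightedShift_single (f : I → J) (c : I → ℂ) (k : I) (r : ℂ) :
    weightedShift f c (single k r) = single (f k) (r * c k) := by
  simp [weightedShift]

/-- The matrix entries of an operator. -/
noncomputable def entry (X : Module.End ℂ (I →₀ ℂ)) (l k : I) : ℂ := X (single k 1) l

theorem entry_mul (X Y : Module.End ℂ (I →₀ ℂ)) (l k : I) (F : Finset I)
    (hF : ∀ h, h ∉ F → entry Y h k = 0) :
    entry (X * Y) l k = ∑ h ∈ F, entry X l h * entry Y h k := by
  have h1 : Y (single k 1) = ∑ h ∈ F, (entry Y h k) • single h (1 : ℂ) := by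
    conv_lhs => rw [← Finsupp.sum_single (Y (single k 1))]
    rw [Finsupp.sum_of_support_subset (s := F)]
    · exact Finset.sum_congr rfl fun h _ => by simp [entry]
    · intro h hh
      by_contra hn
      exact (Finsupp.mem_support_iff.1 hh) (hF h hn)
    · simp
  change X (Y (single k 1)) l = _
  rw [h1, map_sum, Finsupp.finsetSum_apply]
  refine Finset.sum_congr rfl fun h _ => ?_
  rw [map_smul, Finsupp.smul_apply, smul_eq_mul, mul_comm]
  rfl

theorem entry_add (X Y : Module.End ℂ (I →₀ ℂ)) (l k : I) :
    entry (X + Y) l k = entry X l k + entry Y l k := rfl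

theorem entry_algebraMap [DecidableEq I] (r : ℂ) (l k : I) :
    entry (algebraMap ℂ (Module.End ℂ (I →₀ ℂ)) r) l k = if l = k then r else 0 := by
  simp [entry, Module.algebraMap_end_apply, Finsupp.single_apply, eq_comm]

theorem entry_weightedShift [DecidableEq I] (f : I → I) (c : I → ℂ) (l k : I) :
    entry (weightedShift f c) l k = if l = f k then c k else 0 := by
  simp [entry, weightedShift_single, Finsupp.single_apply, eq_comm]

end Entries

/-! ### Toeplitz operators with a symbol -/

/-- `X` is a banded operator on the half line which is asymptotic, along each diagonal, to the
bounded banded operator `Z` on the line. -/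
structure IsToeplitz (X : Module.End ℂ (ℕ →₀ ℂ)) (Z : Module.End ℂ (ℤ →₀ ℂ)) (w : ℕ) (C : ℝ) :
    Prop where
  band : ∀ l k : ℕ, l + w < k ∨ k + w < l → entry X l k = 0
  band_symbol : ∀ l k : ℤ, l + w < k ∨ k + w < l → entry Z l k = 0
  bound : ∀ l k : ℤ, ‖entry Z l k‖ ≤ C
  -- Only the difference is asked to converge: weights such as `phase θ ^ k` oscillate and in
  -- general have no limit.
  tendsto : ∀ i j : ℕ, Tendsto
    (fun n : ℕ => entry X (n + i) (n + j) - entry Z (n + i : ℕ) (n + j : ℕ)) atTop (𝓝 0)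

namespace IsToeplitz

variable {X Y : Module.End ℂ (ℕ →₀ ℂ)} {Z W : Module.End ℂ (ℤ →₀ ℂ)} {w w' : ℕ} {C C' : ℝ}

theorem mono (h : IsToeplitz X Z w C) (hw : w ≤ w') : IsToeplitz X Z w' C where
  band l k hlk := h.band l k (by omega)
  band_symbol l k hlk := h.band_symbol l k (by omega)
  bound := h.bound
  tendsto := h.tendsto

theorem algebraMap (r : ℂ) :
    IsToeplitz (algebraMap ℂ _ r) (algebraMap ℂ _ r) 0 ‖r‖ where
  band l k hlk := by rw [entry_algebraMap, if_neg (by omega)]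
  band_symbol l k hlk := by rw [entry_algebraMap, if_neg (by omega)]
  bound l k := by rw [entry_algebraMap]; split_ifs <;> simp
  tendsto i j := by simp [entry_algebraMap]

theorem add (h : IsToeplitz X Z w C) (h' : IsToeplitz Y W w C') :
    IsToeplitz (X + Y) (Z + W) w (C + C') where
  band l k hlk := by rw [entry_add, h.band l k hlk, h'.band l k hlk, add_zero]
  band_symbol l k hlk := by
    rw [entry_add, h.band_symbol l k hlk, h'.band_symbol l k hlk, add_zero]
  bound l k := (norm_add_le _ _).trans (add_le_add (h.bound l k) (h'.bound l k))
  tendsto i j := by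
    have := (h.tendsto i j).add (h'.tendsto i j)
    rw [add_zero] at this
    refine this.congr fun n => ?_
    rw [entry_add, entry_add]
    ring

/-- Column `k + w` of a matrix of bandwidth `w` lives in rows `k, …, k + 2w`. Indexing the column
this way avoids subtraction in `ℕ` and gives the half line and the line the same summation window.
-/
theorem entry_mul_eq (h' : IsToeplitz Y W w C') (X : Module.End ℂ (ℕ →₀ ℂ)) (l k : ℕ) :
    entry (X * Y) l (k + w) =
      ∑ i ∈ Finset.range (2 * w + 1), entry X l (k + i) * entry Y (k + i) (k + w) := by
  rw [entry_mul X Y l (k + w) (Finset.Ico k (k + (2 * w + 1))), Finset.sum_Ico_eq_sum_range,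
    Nat.add_sub_cancel_left]
  intro i hi
  rw [Finset.mem_Ico] at hi
  exact h'.band _ _ (by omega)

theorem entry_symbol_mul_eq (h' : IsToeplitz Y W w C') (Z : Module.End ℂ (ℤ →₀ ℂ)) (l k : ℤ) :
    entry (Z * W) l (k + w) =
      ∑ i ∈ Finset.range (2 * w + 1), entry Z l (k + i) * entry W (k + i) (k + w) := by
  classical
  rw [entry_mul Z W l (k + w) ((Finset.range (2 * w + 1)).image fun i : ℕ => k + (i : ℤ)),
    Finset.sum_image (by intro a _ b _ hab; simpa using hab)]
  intro i hi
  refine h'.band_symbol _ _ ?_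
  by_contra hn
  refine hi (Finset.mem_image.2 ⟨(i - k).toNat, Finset.mem_range.2 (by omega), by omega⟩)

/-- Each entry of a product is a sum of `2w + 1` products, a number independent of the position, so
limits pass through termwise via `xy - zw = (x - z)(y - w) + (x - z)w + z(y - w)`, where `z, w` are
bounded entries of the symbols. -/
theorem mul (h : IsToeplitz X Z w C) (h' : IsToeplitz Y W w C') :
    IsToeplitz (X * Y) (Z * W) (2 * w) ((2 * w + 1 : ℕ) * (C * C')) where
  band l k hlk := by
    rw [entry_mul X Y l k (Finset.range (k + w + 1)) fun i hi => h'.band _ _ (by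
      rw [Finset.mem_range] at hi; omega)]
    refine Finset.sum_eq_zero fun i _ => ?_
    by_cases hi : l + w < i ∨ i + w < l
    · rw [h.band _ _ hi, zero_mul]
    · rw [h'.band i k (by omega), mul_zero]
  band_symbol l k hlk := by
    rw [← sub_add_cancel k (w : ℤ), entry_symbol_mul_eq h']
    refine Finset.sum_eq_zero fun i hi => ?_
    rw [Finset.mem_range] at hi
    rw [h.band_symbol _ _ (by push_cast at hlk; omega), zero_mul]
  bound l k := by
    rw [← sub_add_cancel k (w : ℤ), entry_symbol_mul_eq h']
    refine (norm_sum_le_of_le _ fun i _ => ?_).trans (b := ∑ _i ∈ Finset.range (2 * w + 1), C * C')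
      (by simp)
    rw [norm_mul]
    exact mul_le_mul (h.bound _ _) (h'.bound _ _) (norm_nonneg _)
      ((norm_nonneg _).trans (h.bound 0 0))
  tendsto i j := by
    -- Replacing `n` by `n + w` puts the column index in the form `(n + j) + w`.
    rw [← tendsto_add_atTop_iff_nat w]
    have key : ∀ m ∈ Finset.range (2 * w + 1), Tendsto (fun n : ℕ =>
        entry X (n + w + i) (n + j + m) * entry Y (n + j + m) (n + j + w) -
        entry Z ((n + w + i : ℕ) : ℤ) ((n + j + m : ℕ) : ℤ) *
          entry W ((n + j + m : ℕ) : ℤ) ((n + j + w : ℕ) : ℤ)) atTop (𝓝 0) := by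
      intro m _
      have t1 := h.tendsto (w + i) (j + m)
      have t2 := h'.tendsto (j + m) (j + w)
      have b1 : IsBoundedUnder (· ≤ ·) atTop ((fun x => ‖x‖) ∘ fun n : ℕ =>
          entry Z ((n + (w + i) : ℕ) : ℤ) ((n + (j + m) : ℕ) : ℤ)) :=
        isBoundedUnder_of ⟨C, fun n => h.bound _ _⟩
      have b2 : IsBoundedUnder (· ≤ ·) atTop ((fun x => ‖x‖) ∘ fun n : ℕ =>
          entry W ((n + (j + m) : ℕ) : ℤ) ((n + (j + w) : ℕ) : ℤ)) :=
        isBoundedUnder_of ⟨C', fun n => h'.bound _ _⟩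
      have := ((t1.mul t2).add (t1.zero_mul_isBoundedUnder_le b2)).add
        (t2.zero_mul_isBoundedUnder_le b1)
      simp only [mul_zero, add_zero] at this
      refine this.congr fun n => ?_
      simp only [add_assoc]
      ring
    have := tendsto_finsetSum _ key
    rw [Finset.sum_const_zero] at this
    refine this.congr fun n => ?_
    rw [Finset.sum_sub_distrib, add_right_comm n w j, entry_mul_eq h' X]
    congr 1
    push_cast
    exact (entry_symbol_mul_eq h' Z _ _).symm

end IsToeplitz

/-- The pairs of an operator on the half line and its symbol on the line. -/
def toeplitzSubalgebra :
    Subalgebra ℂ (Module.End ℂ (ℕ →₀ ℂ) × Module.End ℂ (ℤ →₀ ℂ)) where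
  carrier := {x | ∃ w C, IsToeplitz x.1 x.2 w C}
  mul_mem' := by
    rintro x y ⟨w, C, h⟩ ⟨w', C', h'⟩
    exact ⟨_, _, (h.mono (le_max_left w w')).mul (h'.mono (le_max_right w w'))⟩
  add_mem' := by
    rintro x y ⟨w, C, h⟩ ⟨w', C', h'⟩
    exact ⟨_, _, (h.mono (le_max_left w w')).add (h'.mono (le_max_right w w'))⟩
  algebraMap_mem' r := ⟨0, ‖r‖, IsToeplitz.algebraMap r⟩

/-! ### The index of a Toeplitz operator -/

/-- The truncated trace of the commutator of two banded operators is a corner term. -/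
theorem corner_sum_eq_zero {X Y : Module.End ℂ (ℕ →₀ ℂ)} {w : ℕ}
    (hX : ∀ l k : ℕ, l + w < k ∨ k + w < l → entry X l k = 0)
    (hY : ∀ l k : ℕ, l + w < k ∨ k + w < l → entry Y l k = 0) (hXY : X * Y = Y * X) (n : ℕ) :
    ∑ g ∈ Finset.range w, ∑ h ∈ Finset.range w,
      (entry X (n + g) (n + w + h) * entry Y (n + w + h) (n + g) -
        entry Y (n + g) (n + w + h) * entry X (n + w + h) (n + g)) = 0 := by
  -- For `k < n + w` the band keeps every contributing intermediate index below `n + 2w`.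
  have hdiag : ∀ k ∈ Finset.range (n + w), ∑ l ∈ Finset.range (n + w + w),
      (entry X k l * entry Y l k - entry Y k l * entry X l k) = 0 := by
    intro k hk
    rw [Finset.mem_range] at hk
    have e1 := entry_mul X Y k k (Finset.range (n + w + w)) fun i hi => hY _ _ (by
      rw [Finset.mem_range] at hi; omega)
    have e2 := entry_mul Y X k k (Finset.range (n + w + w)) fun i hi => hX _ _ (by
      rw [Finset.mem_range] at hi; omega)
    rw [Finset.sum_sub_distrib, ← e1, ← e2, hXY, sub_self]
  have hsum := Finset.sum_eq_zero hdiag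
  simp only [Finset.sum_range_add _ (n + w) w, Finset.sum_add_distrib] at hsum
  -- The square block drops out because its summand is antisymmetric in `k, l`.
  have hanti : ∑ k ∈ Finset.range (n + w), ∑ l ∈ Finset.range (n + w),
      (entry X k l * entry Y l k - entry Y k l * entry X l k) = 0 := by
    simp only [Finset.sum_sub_distrib]
    rw [sub_eq_zero, Finset.sum_comm]
    exact Finset.sum_congr rfl fun k _ => Finset.sum_congr rfl fun l _ => mul_comm _ _
  rw [hanti, zero_add, Finset.sum_range_add _ n w] at hsum
  rw [← hsum, right_eq_add]
  -- Rows `k < n` are more than `w` away from columns `≥ n + w`; only the `w × w` corner survives.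
  refine Finset.sum_eq_zero fun k hk => Finset.sum_eq_zero fun l _ => ?_
  rw [Finset.mem_range] at hk
  rw [hX k _ (by omega), hY k _ (by omega), zero_mul, zero_mul, sub_zero]

/-- The weight of a shift cancels against that of its inverse, so the limiting corner terms see only
the length of the shift. -/
theorem entry_mul_entry_of_shift {Z W : Module.End ℂ (ℤ →₀ ℂ)} {m : ℤ} {c : ℤ → ℂ}
    (hZ : ∀ k, Z (single k 1) = single (k + m) (c k)) (hWZ : W * Z = 1) (l k : ℤ) :
    entry Z l k * entry W k l = if l = k + m then 1 else 0 := by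
  have h1 : c k * W (single (k + m) 1) k = 1 := by
    have := DFunLike.congr_fun (LinearMap.congr_fun hWZ (single k 1)) k
    rw [Module.End.mul_apply, hZ, ← mul_one (c k), ← smul_eq_mul, ← Finsupp.smul_single,
      map_smul] at this
    simpa using this
  split_ifs with h
  · subst h
    simpa [entry, hZ] using h1
  · simp [entry, hZ, Ne.symm h]

/-- The vanishing corner sum tends to minus the number of pairs `g, h < w` with `w + h = g + m`. For
`m ≤ w` there are `m` such pairs, so the limit is the index `-m` of the shift. -/
theorem not_isToeplitz_of_pos_shift {X Y : Module.End ℂ (ℕ →₀ ℂ)} {Z W : Module.End ℂ (ℤ →₀ ℂ)}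
    {w : ℕ} {C C' : ℝ} (hX : IsToeplitz X Z w C) (hY : IsToeplitz Y W w C')
    (hXY : X * Y = Y * X) (hWZ : W * Z = 1) {m : ℕ} {c : ℤ → ℂ}
    (hZ : ∀ k, Z (single k 1) = single (k + m : ℤ) (c k)) : m = 0 := by
  by_contra hm
  -- The shift has a nonzero entry at distance `m` from the diagonal, so it must fit in the band.
  have hmw : m ≤ w := by
    by_contra hlt
    have h1 := entry_mul_entry_of_shift hZ hWZ (0 + m) 0
    rw [if_pos rfl, hX.band_symbol _ _ (by omega), zero_mul] at h1
    exact zero_ne_one h1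
  have key : ∀ g ∈ Finset.range w, ∀ h ∈ Finset.range w, Tendsto (fun n : ℕ =>
      entry X (n + g) (n + w + h) * entry Y (n + w + h) (n + g) -
        entry Y (n + g) (n + w + h) * entry X (n + w + h) (n + g)) atTop
      (𝓝 (-(if w + h = g + m then 1 else 0))) := by
    intro g hg h _
    rw [Finset.mem_range] at hg
    have pr : ∀ i j : ℕ, Tendsto (fun n : ℕ => entry X (n + i) (n + j) * entry Y (n + j) (n + i))
        atTop (𝓝 (if i = j + m then 1 else 0)) := by
      intro i j
      have t1 := hX.tendsto i j
      have t2 := hY.tendsto j i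
      have b1 : IsBoundedUnder (· ≤ ·) atTop ((fun x => ‖x‖) ∘ fun n : ℕ =>
          entry Z ((n + i : ℕ) : ℤ) ((n + j : ℕ) : ℤ)) :=
        isBoundedUnder_of ⟨C, fun n => hX.bound _ _⟩
      have b2 : IsBoundedUnder (· ≤ ·) atTop ((fun x => ‖x‖) ∘ fun n : ℕ =>
          entry W ((n + j : ℕ) : ℤ) ((n + i : ℕ) : ℤ)) :=
        isBoundedUnder_of ⟨C', fun n => hY.bound _ _⟩
      have := (((t1.mul t2).add (t1.zero_mul_isBoundedUnder_le b2)).add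
        (t2.zero_mul_isBoundedUnder_le b1)).add_const (if i = j + m then (1 : ℂ) else 0)
      simp only [mul_zero, zero_add] at this
      refine this.congr fun n => ?_
      have e := entry_mul_entry_of_shift hZ hWZ ((n + i : ℕ) : ℤ) ((n + j : ℕ) : ℤ)
      have hiff : ((n + i : ℕ) : ℤ) = ((n + j : ℕ) : ℤ) + m ↔ i = j + m := by omega
      simp only [hiff] at e
      rw [← e]
      ring
    -- The first product has limit zero: it would need `g = w + h + m`, but `g < w`.
    have := (pr g (w + h)).sub (pr (w + h) g)
    rw [if_neg (by omega), zero_sub] at this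
    refine this.congr fun n => ?_
    rw [add_assoc, mul_comm (entry X (n + (w + h)) (n + g))]
  have lim := tendsto_finsetSum _ fun g hg => tendsto_finsetSum _ (key g hg)
  simp only [corner_sum_eq_zero hX.band hY.band hXY] at lim
  have h0 := tendsto_nhds_unique lim tendsto_const_nhds
  simp only [Finset.sum_neg_distrib, neg_eq_zero] at h0
  norm_cast at h0
  rw [Finset.sum_eq_zero_iff] at h0
  -- A vanishing sum of natural numbers has only zero terms; the pair `(w - 1, m - 1)`, available
  -- since `1 ≤ m ≤ w`, contributes `1`.
  have h1 := h0 (w - 1) (Finset.mem_range.2 (by omega))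
  rw [Finset.sum_eq_zero_iff] at h1
  have h2 := h1 (m - 1) (Finset.mem_range.2 (by omega))
  rw [if_pos (by omega)] at h2
  exact one_ne_zero h2

/-- An invertible Toeplitz operator whose symbol is a weighted shift has shift length zero. -/
theorem shift_eq_zero_of_mem_toeplitzSubalgebra
    {x y : Module.End ℂ (ℕ →₀ ℂ) × Module.End ℂ (ℤ →₀ ℂ)} (hx : x ∈ toeplitzSubalgebra)
    (hy : y ∈ toeplitzSubalgebra) (hxy : x * y = 1) (hyx : y * x = 1) {m : ℤ} {c : ℤ → ℂ}
    (hc : ∀ k, c k ≠ 0) (hm : ∀ k, x.2 (single k 1) = single (k + m) (c k)) : m = 0 := by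
  obtain ⟨w₁, C, h₁⟩ := hx
  obtain ⟨w₂, C', h₂⟩ := hy
  have hX := h₁.mono (le_max_left w₁ w₂)
  have hY := h₂.mono (le_max_right w₁ w₂)
  have hcomm : x.1 * y.1 = y.1 * x.1 := congrArg Prod.fst (hxy.trans hyx.symm)
  have hWZ : y.2 * x.2 = 1 := congrArg Prod.snd hyx
  have hZW : x.2 * y.2 = 1 := congrArg Prod.snd hxy
  obtain ⟨n, rfl | rfl⟩ := m.eq_nat_or_neg
  · exact_mod_cast not_isToeplitz_of_pos_shift hX hY hcomm hWZ hm
  -- For a negative shift the inverse shifts forward by `n`, and `x`, `y` exchange roles.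
  · have hinv : ∀ k : ℤ, y.2 (single k 1) = single (k + n) ((c (k + n))⁻¹) := by
      intro k
      have h1 := LinearMap.congr_fun hWZ (single (k + n) (c (k + n))⁻¹)
      rw [Module.End.mul_apply, ← mul_one (c (k + n))⁻¹, ← smul_eq_mul, ← Finsupp.smul_single,
        map_smul, hm, Finsupp.smul_single, smul_eq_mul, inv_mul_cancel₀ (hc _),
        add_neg_cancel_right] at h1
      simpa using h1
    have := not_isToeplitz_of_pos_shift hY hX hcomm.symm hZW hinv
    simp [this]

/-! ### Representations of the sphere algebra -/

section Lift

variable (p q θ : ℝ)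

/-- An algebra homomorphism out of `O(S³_{pqθ})` given by its values on the generators. -/
noncomputable def sphereLift {A : Type*} [Ring A] [Algebra ℂ A] (φ : Gen → A)
    (hφ : ∀ ⦃x y⦄, SphereRel p q θ x y → FreeAlgebra.lift ℂ φ x = FreeAlgebra.lift ℂ φ y) :
    OSphere p q θ →ₐ[ℂ] A :=
  RingQuot.liftAlgHom ℂ ⟨FreeAlgebra.lift ℂ φ, hφ⟩

variable {p q θ}

theorem sphereLift_gen {A : Type*} [Ring A] [Algebra ℂ A] {φ : Gen → A}
    (hφ : ∀ ⦃x y⦄, SphereRel p q θ x y → FreeAlgebra.lift ℂ φ x = FreeAlgebra.lift ℂ φ y)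
    (g : Gen) : sphereLift p q θ φ hφ (gen p q θ g) = φ g := by
  simp [sphereLift, gen, letter]

theorem mem_of_gen_mem (S : Subalgebra ℂ (OSphere p q θ)) (h : ∀ g, gen p q θ g ∈ S)
    (x : OSphere p q θ) : x ∈ S := by
  obtain ⟨y, rfl⟩ := RingQuot.mkAlgHom_surjective ℂ (SphereRel p q θ) x
  induction y using FreeAlgebra.induction with
  | grade0 r => rw [AlgHom.commutes]; exact S.algebraMap_mem r
  | grade1 g => exact h g
  | mul a b ha hb => rw [map_mul]; exact S.mul_mem ha hb
  | add a b ha hb => rw [map_add]; exact S.add_mem ha hb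

/-- Linear maps intertwining two representations on the generators intertwine them. -/
theorem intertwine {V W : Type*} [AddCommGroup V] [Module ℂ V] [AddCommGroup W] [Module ℂ W]
    (f : OSphere p q θ →ₐ[ℂ] Module.End ℂ V) (f' : OSphere p q θ →ₐ[ℂ] Module.End ℂ W)
    (U : V →ₗ[ℂ] W) (h : ∀ g, U ∘ₗ f (gen p q θ g) = f' (gen p q θ g) ∘ₗ U)
    (x : OSphere p q θ) (v : V) : U (f x v) = f' x (U v) := by
  let S : Subalgebra ℂ (OSphere p q θ) :=
    { carrier := {x | ∀ v, U (f x v) = f' x (U v)}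
      mul_mem' := fun {a b} ha hb v => by simp [ha _, hb _]
      add_mem' := fun {a b} ha hb v => by simp [ha _, hb _]
      algebraMap_mem' := fun r v => by simp }
  exact mem_of_gen_mem S (fun g => LinearMap.congr_fun (h g)) x v

/-- Generators of a representation in which `b` is unitary. -/
theorem lift_rel_of_unitary_b {A : Type*} [Ring A] [Algebra ℂ A] {φ : Gen → A}
    (hab : φ .a * φ .b = phase θ • (φ .b * φ .a))
    (hba : φ .bStar * φ .aStar = phase (-θ) • (φ .aStar * φ .bStar))
    (hab' : φ .a * φ .bStar = phase (-θ) • (φ .bStar * φ .a))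
    (hba' : φ .b * φ .aStar = phase θ • (φ .aStar * φ .b))
    (ha : φ .aStar * φ .a - (p : ℂ) • (φ .a * φ .aStar) = algebraMap ℂ A (1 - p))
    (hb : φ .b * φ .bStar = 1) (hb' : φ .bStar * φ .b = 1)
    ⦃x y : FreeAlgebra ℂ Gen⦄ (h : SphereRel p q θ x y) :
    FreeAlgebra.lift ℂ φ x = FreeAlgebra.lift ℂ φ y := by
  -- Since `b b* = 1`, both sphere relations have a zero factor and the disc relation for `b`
  -- becomes trivial.
  cases h <;> simp only [letter, map_mul, map_sub, map_smul, map_one, map_zero,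
    FreeAlgebra.lift_ι_apply, AlgHom.commutes, *]
  · simp [Algebra.algebraMap_eq_smul_one]
  · simp
  · simp

/-- Generators of a representation in which `a` is unitary. -/
theorem lift_rel_of_unitary_a {A : Type*} [Ring A] [Algebra ℂ A] {φ : Gen → A}
    (hab : φ .a * φ .b = phase θ • (φ .b * φ .a))
    (hba : φ .bStar * φ .aStar = phase (-θ) • (φ .aStar * φ .bStar))
    (hab' : φ .a * φ .bStar = phase (-θ) • (φ .bStar * φ .a))
    (hba' : φ .b * φ .aStar = phase θ • (φ .aStar * φ .b))
    (hb : φ .bStar * φ .b - (q : ℂ) • (φ .b * φ .bStar) = algebraMap ℂ A (1 - q))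
    (ha : φ .a * φ .aStar = 1) (ha' : φ .aStar * φ .a = 1)
    ⦃x y : FreeAlgebra ℂ Gen⦄ (h : SphereRel p q θ x y) :
    FreeAlgebra.lift ℂ φ x = FreeAlgebra.lift ℂ φ y := by
  cases h <;> simp only [letter, map_mul, map_sub, map_smul, map_one, map_zero,
    FreeAlgebra.lift_ι_apply, AlgHom.commutes, *]
  · simp [Algebra.algebraMap_eq_smul_one]
  · simp
  · simp

end Lift

theorem phase_ne_zero (θ : ℝ) : phase θ ≠ 0 := Complex.exp_ne_zero _

theorem phase_neg (θ : ℝ) : phase (-θ) = (phase θ)⁻¹ := by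
  simp [phase, ← Complex.exp_neg]

theorem norm_phase (θ : ℝ) : ‖phase θ‖ = 1 := by
  rw [phase, show (2 * Real.pi * Complex.I * θ : ℂ) = ((2 * Real.pi * θ : ℝ) : ℂ) * Complex.I by
    push_cast; ring]
  exact Complex.norm_exp_ofReal_mul_I _

theorem weightedShift_mul {I : Type*} (f g : I → I) (c d : I → ℂ) :
    (weightedShift f c * weightedShift g d : Module.End ℂ (I →₀ ℂ)) =
      weightedShift (f ∘ g) fun k => d k * c (g k) := by
  refine Finsupp.lhom_ext fun k r => ?_
  simp [weightedShift_single, mul_assoc, -Finsupp.single_mul]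

theorem smul_weightedShift {I : Type*} (f : I → I) (c : I → ℂ) (r : ℂ) :
    r • (weightedShift f c : Module.End ℂ (I →₀ ℂ)) = weightedShift f fun k => r * c k := by
  refine Finsupp.lhom_ext fun k s => ?_
  simp [weightedShift_single, mul_left_comm, -Finsupp.single_mul]

/-! ### Representations on the torus, the line and the half line -/

section Representations

variable (θ : ℝ)

/-- The generators acting on the quantum torus. -/
noncomputable def torusGen : Gen → Module.End ℂ (ℤ × ℤ →₀ ℂ)
  | .a => weightedShift (fun k => (k.1 + 1, k.2)) fun _ => 1
  | .aStar => weightedShift (fun k => (k.1 - 1, k.2)) fun _ => 1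
  | .b => weightedShift (fun k => (k.1, k.2 + 1)) fun k => phase θ ^ (-k.1)
  | .bStar => weightedShift (fun k => (k.1, k.2 - 1)) fun k => phase θ ^ k.1

/-- The generators acting on the line, with `a` the shift. -/
noncomputable def lineGenA : Gen → Module.End ℂ (ℤ →₀ ℂ)
  | .a => weightedShift (fun k => k + 1) fun _ => 1
  | .aStar => weightedShift (fun k => k - 1) fun _ => 1
  | .b => weightedShift (fun k => k) fun k => phase θ ^ (-k)
  | .bStar => weightedShift (fun k => k) fun k => phase θ ^ k

/-- The generators acting on the line, with `b` the shift. -/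
noncomputable def lineGenB : Gen → Module.End ℂ (ℤ →₀ ℂ)
  | .a => weightedShift (fun k => k) fun k => phase θ ^ k
  | .aStar => weightedShift (fun k => k) fun k => phase θ ^ (-k)
  | .b => weightedShift (fun k => k + 1) fun _ => 1
  | .bStar => weightedShift (fun k => k - 1) fun _ => 1

/-- The generators acting on the half line, with `a` the shift. -/
noncomputable def discGenA (p : ℝ) : Gen → Module.End ℂ (ℕ →₀ ℂ)
  | .a => weightedShift (fun k => k + 1) fun _ => 1
  -- The weight vanishes at `k = 0`, so the truncated `0 - 1` is harmless. Putting all the weight on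
  -- `a*` avoids square roots; only an algebra representation is needed, not a `*`-representation.
  | .aStar => weightedShift (fun k => k - 1) fun k => 1 - (p : ℂ) ^ k
  | .b => weightedShift (fun k => k) fun k => phase θ ^ (-(k : ℤ))
  | .bStar => weightedShift (fun k => k) fun k => phase θ ^ (k : ℤ)

/-- The generators acting on the half line, with `b` the shift. -/
noncomputable def discGenB (q : ℝ) : Gen → Module.End ℂ (ℕ →₀ ℂ)
  | .a => weightedShift (fun k => k) fun k => phase θ ^ (k : ℤ)
  | .aStar => weightedShift (fun k => k) fun k => phase θ ^ (-(k : ℤ))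
  | .b => weightedShift (fun k => k + 1) fun _ => 1
  | .bStar => weightedShift (fun k => k - 1) fun k => 1 - (q : ℂ) ^ k

variable (p q : ℝ)

theorem discGenA_rel ⦃x y : FreeAlgebra ℂ Gen⦄ (h : SphereRel p q θ x y) :
    FreeAlgebra.lift ℂ (discGenA θ p) x = FreeAlgebra.lift ℂ (discGenA θ p) y := by
  have h0 := phase_ne_zero θ
  refine lift_rel_of_unitary_b (φ := discGenA θ p) ?_ ?_ ?_ ?_ ?_ ?_ ?_ h <;>
  refine Finsupp.lhom_ext fun k r => ?_ <;> rcases k with _ | k <;>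
  simp [discGenA, weightedShift_mul, smul_weightedShift, weightedShift_single, phase_neg,
    zpow_neg, h0, Module.algebraMap_end_apply, ← Finsupp.single_sub,
    -Finsupp.single_mul]
  all_goals try congr 1
  all_goals field_simp
  all_goals ring

theorem discGenB_rel ⦃x y : FreeAlgebra ℂ Gen⦄ (h : SphereRel p q θ x y) :
    FreeAlgebra.lift ℂ (discGenB θ q) x = FreeAlgebra.lift ℂ (discGenB θ q) y := by
  have h0 := phase_ne_zero θ
  refine lift_rel_of_unitary_a (φ := discGenB θ q) ?_ ?_ ?_ ?_ ?_ ?_ ?_ h <;>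
  refine Finsupp.lhom_ext fun k r => ?_ <;> rcases k with _ | k <;>
  simp [discGenB, weightedShift_mul, smul_weightedShift, weightedShift_single, phase_neg,
    zpow_neg, h0, Module.algebraMap_end_apply, ← Finsupp.single_sub,
    -Finsupp.single_mul]
  all_goals try congr 1
  all_goals field_simp
  all_goals ring

theorem lineGenA_rel ⦃x y : FreeAlgebra ℂ Gen⦄ (h : SphereRel p q θ x y) :
    FreeAlgebra.lift ℂ (lineGenA θ) x = FreeAlgebra.lift ℂ (lineGenA θ) y := by
  have h0 := phase_ne_zero θ
  refine lift_rel_of_unitary_b (φ := lineGenA θ) ?_ ?_ ?_ ?_ ?_ ?_ ?_ h <;>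
  refine Finsupp.lhom_ext fun k r => ?_ <;>
  simp [lineGenA, weightedShift_mul, smul_weightedShift, weightedShift_single, phase_neg,
    zpow_add₀, zpow_sub₀, zpow_neg, h0, Module.algebraMap_end_apply, ← Finsupp.single_sub,
    -Finsupp.single_mul]
  all_goals try congr 1
  all_goals field_simp

theorem lineGenB_rel ⦃x y : FreeAlgebra ℂ Gen⦄ (h : SphereRel p q θ x y) :
    FreeAlgebra.lift ℂ (lineGenB θ) x = FreeAlgebra.lift ℂ (lineGenB θ) y := by
  have h0 := phase_ne_zero θ
  refine lift_rel_of_unitary_a (φ := lineGenB θ) ?_ ?_ ?_ ?_ ?_ ?_ ?_ h <;>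
  refine Finsupp.lhom_ext fun k r => ?_ <;>
  simp [lineGenB, weightedShift_mul, smul_weightedShift, weightedShift_single, phase_neg,
    zpow_add₀, zpow_sub₀, zpow_neg, h0, Module.algebraMap_end_apply, ← Finsupp.single_sub,
    -Finsupp.single_mul]
  all_goals try congr 1
  all_goals field_simp

theorem torusGen_rel ⦃x y : FreeAlgebra ℂ Gen⦄ (h : SphereRel p q θ x y) :
    FreeAlgebra.lift ℂ (torusGen θ) x = FreeAlgebra.lift ℂ (torusGen θ) y := by
  have h0 := phase_ne_zero θ
  refine lift_rel_of_unitary_b (φ := torusGen θ) ?_ ?_ ?_ ?_ ?_ ?_ ?_ h <;>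
  refine Finsupp.lhom_ext fun k r => ?_ <;>
  simp [torusGen, weightedShift_mul, smul_weightedShift, weightedShift_single, phase_neg,
    zpow_add₀, zpow_sub₀, zpow_neg, h0, Module.algebraMap_end_apply, ← Finsupp.single_sub,
    -Finsupp.single_mul]
  all_goals try congr 1
  all_goals field_simp

end Representations

/-! ### Units of the sphere algebra and their symbols -/

section Units

variable (p q θ : ℝ)

/-- The representation factoring through the quantum torus. -/
noncomputable def torusRep : OSphere p q θ →ₐ[ℂ] Module.End ℂ (ℤ × ℤ →₀ ℂ) :=
  sphereLift p q θ (torusGen θ) (torusGen_rel θ p q)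

/-- The Toeplitz representation with `a` the shift, together with its symbol. -/
noncomputable def toeplitzRepA :
    OSphere p q θ →ₐ[ℂ] Module.End ℂ (ℕ →₀ ℂ) × Module.End ℂ (ℤ →₀ ℂ) :=
  (sphereLift p q θ (discGenA θ p) (discGenA_rel θ p q)).prod
    (sphereLift p q θ (lineGenA θ) (lineGenA_rel θ p q))

/-- The Toeplitz representation with `b` the shift, together with its symbol. -/
noncomputable def toeplitzRepB :
    OSphere p q θ →ₐ[ℂ] Module.End ℂ (ℕ →₀ ℂ) × Module.End ℂ (ℤ →₀ ℂ) :=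
  (sphereLift p q θ (discGenB θ q) (discGenB_rel θ p q)).prod
    (sphereLift p q θ (lineGenB θ) (lineGenB_rel θ p q))

/-- The maps `f` and `g` are compared only at positive indices: the truncated `k - 1` on `ℕ` differs
from that on `ℤ` at `0`, which asymptotics ignore. -/
theorem weightedShift_mem_toeplitzSubalgebra {f : ℕ → ℕ} {g : ℤ → ℤ} {c : ℕ → ℂ} {d : ℤ → ℂ}
    (hf : ∀ k, f k ≤ k + 1 ∧ k ≤ f k + 1) (hg : ∀ k, g k ≤ k + 1 ∧ k ≤ g k + 1)
    (hd : ∀ k, ‖d k‖ = 1) (hfg : ∀ k : ℕ, ((f (k + 1) : ℕ) : ℤ) = g (k + 1 : ℕ))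
    (hcd : Tendsto (fun k : ℕ => c k - d k) atTop (𝓝 0)) :
    ((weightedShift f c, weightedShift g d) :
      Module.End ℂ (ℕ →₀ ℂ) × Module.End ℂ (ℤ →₀ ℂ)) ∈ toeplitzSubalgebra := by
  refine ⟨1, 1, ?_, ?_, ?_, ?_⟩
  · intro l k hlk
    have := hf k
    rw [entry_weightedShift, if_neg (by omega)]
  · intro l k hlk
    have := hg k
    rw [entry_weightedShift, if_neg (by omega)]
  · intro l k
    rw [entry_weightedShift]
    split_ifs
    · exact (hd k).le
    · simp
  · intro i j
    have hcd' : Tendsto (fun n : ℕ => c (n + j) - d (n + j : ℕ)) atTop (𝓝 0) :=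
      (tendsto_add_atTop_iff_nat (f := fun k : ℕ => c k - d k) j).2 hcd
    refine squeeze_zero_norm' ?_ (tendsto_zero_iff_norm_tendsto_zero.1 hcd')
    filter_upwards [eventually_ge_atTop 1] with n hn
    obtain ⟨m, hm⟩ : ∃ m, n + j = m + 1 := ⟨n + j - 1, by omega⟩
    have := hfg m
    rw [entry_weightedShift, entry_weightedShift, hm]
    by_cases h : n + i = f (m + 1)
    · rw [if_pos h, if_pos (by omega)]
    · rw [if_neg h, if_neg (by omega)]
      simp

variable {p q θ}

theorem norm_phase_zpow (k : ℤ) : ‖phase θ ^ k‖ = 1 := by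
  rw [norm_zpow, norm_phase, one_zpow]

theorem tendsto_one_sub_pow {r : ℝ} (hr : 0 ≤ r ∧ r < 1) :
    Tendsto (fun k : ℕ => (1 - (r : ℂ) ^ k) - 1) atTop (𝓝 0) := by
  have : Tendsto (fun k : ℕ => (r : ℂ) ^ k) atTop (𝓝 0) :=
    tendsto_pow_atTop_nhds_zero_of_norm_lt_one (by simpa [abs_of_nonneg hr.1] using hr.2)
  simpa using this.neg

theorem toeplitzRepA_mem (hp : 0 ≤ p ∧ p < 1) (x : OSphere p q θ) :
    toeplitzRepA p q θ x ∈ toeplitzSubalgebra := by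
  refine mem_of_gen_mem (toeplitzSubalgebra.comap (toeplitzRepA p q θ)) (fun g => ?_) x
  rw [Subalgebra.mem_comap, toeplitzRepA, AlgHom.prod_apply, sphereLift_gen, sphereLift_gen]
  cases g <;> refine weightedShift_mem_toeplitzSubalgebra ?_ ?_ ?_ ?_ ?_ <;>
    first | (intro k; omega) | (intro k; exact norm_phase_zpow _) |
      exact tendsto_one_sub_pow hp | simp

theorem toeplitzRepB_mem (hq : 0 ≤ q ∧ q < 1) (x : OSphere p q θ) :
    toeplitzRepB p q θ x ∈ toeplitzSubalgebra := by
  refine mem_of_gen_mem (toeplitzSubalgebra.comap (toeplitzRepB p q θ)) (fun g => ?_) x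
  rw [Subalgebra.mem_comap, toeplitzRepB, AlgHom.prod_apply, sphereLift_gen, sphereLift_gen]
  cases g <;> refine weightedShift_mem_toeplitzSubalgebra ?_ ?_ ?_ ?_ ?_ <;>
    first | (intro k; omega) | (intro k; exact norm_phase_zpow _) |
      exact tendsto_one_sub_pow hq | simp

/-- Forgetting the exponent of `b` intertwines the torus with the line, since the phase of `b`
depends only on the exponent of `a`. Thus the torus symbol determines the line symbol. -/
theorem toeplitzRepA_symbol (x : OSphere p q θ) (v : ℤ × ℤ →₀ ℂ) :
    weightedShift Prod.fst (fun _ => 1) (torusRep p q θ x v) =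
      (toeplitzRepA p q θ x).2 (weightedShift Prod.fst (fun _ => 1) v) := by
  refine intertwine (torusRep p q θ) (sphereLift p q θ (lineGenA θ) (lineGenA_rel θ p q)) _
    (fun g => ?_) x v
  rw [torusRep, sphereLift_gen, sphereLift_gen]
  cases g <;> refine Finsupp.lhom_ext fun k r => ?_ <;>
    simp [torusGen, lineGenA, weightedShift_single, -Finsupp.single_mul]

/-- The twist `phase θ ^ (i * j)` moves the phase from `b` to `a`: it cancels the factor `phase θ ^
(-i)` of `b` and creates `phase θ ^ j` for `a`. -/
theorem toeplitzRepB_symbol (x : OSphere p q θ) (v : ℤ × ℤ →₀ ℂ) :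
    weightedShift Prod.snd (fun k => phase θ ^ (k.1 * k.2)) (torusRep p q θ x v) =
      (toeplitzRepB p q θ x).2
        (weightedShift Prod.snd (fun k => phase θ ^ (k.1 * k.2)) v) := by
  have h0 := phase_ne_zero θ
  refine intertwine (torusRep p q θ) (sphereLift p q θ (lineGenB θ) (lineGenB_rel θ p q)) _
    (fun g => ?_) x v
  rw [torusRep, sphereLift_gen, sphereLift_gen]
  cases g <;> refine Finsupp.lhom_ext fun k r => ?_ <;>
    simp only [torusGen, lineGenB, weightedShift_single, LinearMap.comp_apply, mul_one] <;>
    rw [mul_assoc, ← zpow_add₀ h0] <;> ring_nf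

/-- The right translations of the quantum torus. -/
noncomputable def torusTranslation (θ : ℝ) (k : ℤ × ℤ) : Module.End ℂ (ℤ × ℤ →₀ ℂ) :=
  weightedShift (fun l => l + k) fun l => phase θ ^ (-(l.2 * k.1))

/-- With `e_(i,j)` read as `aⁱ bʲ`, `torusRep` is left multiplication and `torusTranslation` right
multiplication by a monomial, so they commute. Hence `torusRep x` is determined by its value at
`e_0`. -/
theorem torusRep_translation (x : OSphere p q θ) (k : ℤ × ℤ) (v : ℤ × ℤ →₀ ℂ) :
    torusTranslation θ k (torusRep p q θ x v) = torusRep p q θ x (torusTranslation θ k v) := by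
  have h0 := phase_ne_zero θ
  refine intertwine (torusRep p q θ) (torusRep p q θ) _ (fun g => ?_) x v
  rw [torusRep, sphereLift_gen]
  obtain ⟨i, j⟩ := k
  cases g <;> refine Finsupp.lhom_ext fun l r => ?_ <;>
    simp only [torusGen, torusTranslation, weightedShift_single, LinearMap.comp_apply, mul_one,
      Prod.fst_add, Prod.snd_add, mul_assoc, ← zpow_add₀ h0] <;>
    congr 1 <;> first | (ext <;> simp <;> ring) | ring_nf

theorem torusRep_single (x : OSphere p q θ) (k : ℤ × ℤ) :
    torusRep p q θ x (single k 1) = torusTranslation θ k (torusRep p q θ x (single 0 1)) := by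
  rw [torusRep_translation, torusTranslation, weightedShift_single]
  simp

theorem torusTranslation_apply (k l : ℤ × ℤ) (s : ℤ × ℤ →₀ ℂ) :
    torusTranslation θ k s l = s (l - k) * phase θ ^ (-((l - k).2 * k.1)) := by
  induction s using Finsupp.induction_linear with
  | zero => simp
  | add s t hs ht => rw [map_add, Finsupp.add_apply, hs, ht, Finsupp.add_apply, add_mul]
  | single m r =>
    rw [torusTranslation, weightedShift_single]
    by_cases h : m + k = l
    · subst h; simp
    · have h' : ¬ m = l - k := fun e => h (by rw [e, sub_add_cancel])
      simp [h, h']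

/-- In the quantum torus, the coefficient of a product at a uniquely represented sum of exponents
does not vanish. -/
theorem torusRep_apply_of_uniqueAdd (x : OSphere p q θ) {s t : ℤ × ℤ →₀ ℂ}
    (hs : torusRep p q θ x (single 0 1) = s) {l k : ℤ × ℤ} (hl : l ∈ s.support)
    (hk : k ∈ t.support) (h : UniqueAdd s.support t.support l k) :
    torusRep p q θ x t (l + k) ≠ 0 := by
  -- Every basis vector is a right translate of `e_0`, so `x` acts on `t` as a twisted convolution
  -- by `s`.
  have h1 : torusRep p q θ x t = ∑ m ∈ t.support, t m • torusTranslation θ m s := by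
    conv_lhs => rw [← Finsupp.sum_single t, Finsupp.sum, map_sum]
    refine Finset.sum_congr rfl fun m _ => ?_
    rw [← mul_one (t m), ← smul_eq_mul, ← Finsupp.smul_single, map_smul, torusRep_single, hs,
      smul_eq_mul, mul_one]
  rw [h1, Finsupp.finsetSum_apply, Finset.sum_eq_single_of_mem k hk]
  · rw [Finsupp.smul_apply, torusTranslation_apply, add_sub_cancel_right, smul_eq_mul]
    exact mul_ne_zero (Finsupp.mem_support_iff.1 hk)
      (mul_ne_zero (Finsupp.mem_support_iff.1 hl) (zpow_ne_zero _ (phase_ne_zero θ)))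
  · intro m hm hmk
    rw [Finsupp.smul_apply, torusTranslation_apply]
    have : s (l + k - m) = 0 := by
      by_contra hne
      exact hmk (h (Finsupp.mem_support_iff.2 hne) hm (sub_add_cancel _ _)).2
    rw [this, zero_mul, smul_zero]

/-- The units of the quantum torus are monomials. -/
theorem exists_torusRep_eq_single {x y : OSphere p q θ} (hxy : x * y = 1) (hyx : y * x = 1) :
    ∃ k c, c ≠ 0 ∧ torusRep p q θ x (single 0 1) = single k c := by
  have ne (x y : OSphere p q θ) (hxy : x * y = 1) : torusRep p q θ y (single 0 1) ≠ 0 := by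
    intro h
    have := congrArg (fun z => torusRep p q θ z (single 0 1)) hxy
    simp only [map_mul, Module.End.mul_apply, h, map_zero, map_one, Module.End.one_apply] at this
    exact one_ne_zero (Finsupp.single_eq_zero.1 this.symm)
  have ht := ne x y hxy
  have hs := ne y x hyx
  set s := torusRep p q θ x (single 0 1) with hs'
  set t := torusRep p q θ y (single 0 1) with ht'
  have hst : torusRep p q θ x t = single 0 1 := by
    rw [ht', ← Module.End.mul_apply, ← map_mul, hxy, map_one, Module.End.one_apply]
  -- Otherwise two distinct pairs of exponents have uniquely represented sums. Both give nonzero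
  -- coefficients of `s t = 1`, so both sums are `0`, contradicting uniqueness.
  have hle : ¬ 1 < s.support.card * t.support.card := by
    intro hlt
    obtain ⟨⟨l, k⟩, hm, ⟨l', k'⟩, hm', hne, hu, hu'⟩ :=
      TwoUniqueSums.uniqueAdd_of_one_lt_card hlt
    rw [Finset.mem_product] at hm hm'
    have key : ∀ l ∈ s.support, ∀ k ∈ t.support, UniqueAdd s.support t.support l k →
        l + k = 0 := by
      intro l hl k hk hu
      have := torusRep_apply_of_uniqueAdd x hs'.symm hl hk hu
      rw [hst] at this
      by_contra h
      exact this (Finsupp.single_eq_of_ne h)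
    have e1 := key l hm.1 k hm.2 hu
    have e2 := key l' hm'.1 k' hm'.2 hu'
    obtain ⟨rfl, rfl⟩ := hu hm'.1 hm'.2 (e2.trans e1.symm)
    exact hne rfl
  have h1 : s.support.card ≠ 0 := by simpa using hs
  have h2 : t.support.card ≠ 0 := by simpa using ht
  have hcard : s.support.card = 1 := by
    refine le_antisymm ?_ (Nat.one_le_iff_ne_zero.2 h1)
    exact (Nat.le_mul_of_pos_right _ (Nat.pos_of_ne_zero h2)).trans (not_lt.1 hle)
  obtain ⟨k, hk, hs1⟩ := Finsupp.card_support_eq_one.1 hcard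
  exact ⟨k, _, hk, hs1⟩

/-- The units of `O(S³_{pqθ})` have constant symbol. -/
theorem exists_torusRep_eq_single_zero (hp : 0 ≤ p ∧ p < 1) (hq : 0 ≤ q ∧ q < 1)
    {x y : OSphere p q θ} (hxy : x * y = 1) (hyx : y * x = 1) :
    ∃ c, c ≠ 0 ∧ torusRep p q θ x (single 0 1) = single 0 c := by
  have h0 := phase_ne_zero θ
  obtain ⟨⟨m, n⟩, c, hc, hx⟩ := exists_torusRep_eq_single hxy hyx
  have hxk (k : ℤ × ℤ) : torusRep p q θ x (single k 1) =
      single ((m, n) + k) (c * phase θ ^ (-(n * k.1))) := by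
    rw [torusRep_single, hx, torusTranslation, weightedShift_single]
  have hm : m = 0 := by
    refine shift_eq_zero_of_mem_toeplitzSubalgebra (toeplitzRepA_mem hp x)
      (toeplitzRepA_mem hp y) (by rw [← map_mul, hxy, map_one]) (by rw [← map_mul, hyx, map_one])
      (c := fun k => c * phase θ ^ (-(n * k))) (fun k => mul_ne_zero hc (zpow_ne_zero _ h0))
      fun k => ?_
    have := toeplitzRepA_symbol x (single (k, 0) 1)
    rw [hxk, weightedShift_single, weightedShift_single, mul_one, mul_one] at this
    rw [← this]
    simp [add_comm, -Finsupp.single_mul]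
  have hn : n = 0 := by
    refine shift_eq_zero_of_mem_toeplitzSubalgebra (toeplitzRepB_mem hq x)
      (toeplitzRepB_mem hq y) (by rw [← map_mul, hxy, map_one]) (by rw [← map_mul, hyx, map_one])
      (c := fun k => c * phase θ ^ (m * (n + k)))
      (fun k => mul_ne_zero hc (zpow_ne_zero _ h0)) fun k => ?_
    -- On `e_(0,k)` the twist is trivial, so it enters only through the image, as `phase θ ^ (m * (n
    -- + k))`.
    have := toeplitzRepB_symbol x (single (0, k) 1)
    rw [hxk, weightedShift_single, weightedShift_single] at this
    simp only [zero_mul, zpow_zero, mul_one, mul_zero, neg_zero] at this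
    rw [← this]
    simp [add_comm, -Finsupp.single_mul]
  subst hm hn
  exact ⟨c, hc, hx⟩

/-- An automorphism scaling the generators by the grading scales no unit nontrivially. -/
theorem eq_one_of_unit_of_scaling (hp : 0 ≤ p ∧ p < 1) (hq : 0 ≤ q ∧ q < 1) {ζ : ℂ}
    (hζ : ζ ≠ 0) {α : OSphere p q θ →ₐ[ℂ] OSphere p q θ}
    (hα : ∀ g, α (gen p q θ g) = ζ ^ g.deg • gen p q θ g) {x y : OSphere p q θ}
    (hxy : x * y = 1) (hyx : y * x = 1) (hx : α x = ζ • x) : ζ = 1 := by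
  obtain ⟨c, hc, hs⟩ := exists_torusRep_eq_single_zero hp hq hxy hyx
  -- The grading operator `ζ ^ (i + j)` implements `α` on the torus. It fixes `e_0`, so evaluating
  -- at `e_0` yields `c = ζ c`.
  have := intertwine (torusRep p q θ) ((torusRep p q θ).comp α)
    (weightedShift (fun k => k) fun k : ℤ × ℤ => ζ ^ (k.1 + k.2)) (fun g => by
      rw [AlgHom.comp_apply, hα, map_smul, torusRep, sphereLift_gen]
      cases g <;> refine Finsupp.lhom_ext fun k r => ?_ <;>
        simp [torusGen, weightedShift_single, Gen.deg, zpow_add₀, zpow_sub₀, hζ,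
          -Finsupp.single_mul] <;>
        congr 1 <;> field_simp) x (single 0 1)
  rw [AlgHom.comp_apply, hx, hs, weightedShift_single, weightedShift_single] at this
  simp only [Prod.fst_zero, Prod.snd_zero, add_zero, zpow_zero, mul_one, map_smul,
    LinearMap.smul_apply, hs, Finsupp.smul_single, smul_eq_mul] at this
  have h1 := Finsupp.single_injective _ this
  exact mul_right_cancel₀ hc (by rw [one_mul]; exact h1.symm)

end Units

/-! ### Cleaving maps of a prolongation -/

section Prolongation

universe u v w x

variable {k : Type u} [Field k] {H : Type v} [Ring H] [HopfAlgebra k H]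
  {P : Type w} [Ring P] [Algebra k P] {V : Type x} [Ring V] [HopfAlgebra k V]

/-- The homomorphism `id ⊗ χ : P ⊗ A → P` for a character `χ`. -/
noncomputable def evalRight {A : Type*} [Ring A] [Algebra k A] (P : Type w) [Ring P] [Algebra k P]
    (χ : A →ₐ[k] k) : P ⊗[k] A →ₐ[k] P :=
  ((Algebra.TensorProduct.rid k k P : P ⊗[k] k →ₐ[k] P)).comp
    (Algebra.TensorProduct.map (AlgHom.id k P) χ)

theorem evalRight_tmul {A : Type*} [Ring A] [Algebra k A] (χ : A →ₐ[k] k) (p : P) (a : A) :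
    evalRight P χ (p ⊗ₜ a) = χ a • p := by
  simp [evalRight]

/-- This is the counit axiom in the `V` factor. It recovers an element of `P ⊗ V` from its coaction,
so that an element with coaction `ξ ⊗ g` must be a pure tensor. -/
theorem evalRight_counit_tensorCoact (z : P ⊗[k] V) :
    (evalRight P (Bialgebra.counitAlgHom k V)).toLinearMap.rTensor V (tensorCoact k P V z) = z := by
  induction z using TensorProduct.induction_on with
  | zero => simp
  | add x y hx hy => rw [map_add, map_add, hx, hy]
  | tmul p v =>
    have h1 : ∀ t : V ⊗[k] V, (evalRight P (Bialgebra.counitAlgHom k V)).toLinearMap.rTensor V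
        ((TensorProduct.assoc k P V V).symm (p ⊗ₜ t)) =
        p ⊗ₜ TensorProduct.lid k V (Coalgebra.counit.rTensor V t) := by
      intro t
      induction t using TensorProduct.induction_on with
      | zero => simp
      | add x y hx hy => simp only [TensorProduct.tmul_add, map_add, hx, hy]
      | tmul x y => simp [evalRight_tmul, TensorProduct.smul_tmul]
    rw [tensorCoact_tmul, h1, Coalgebra.rTensor_counit_comul]
    simp

/-- The image of a group-like element under a cleaving map of `P □_H V` is of the form `x ⊗ g`
with `x` a unit of `P` that transforms according to `π g`. -/
theorem exists_unit_of_isCleavingMap (ρ : RightComoduleAlgebra k H P) (π : V →ₐc[k] H)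
    {j : V →ₗ[k] prolongationSubalgebra ρ π} (hj : (prolongation ρ π).IsCleavingMap j)
    {g : V} (hg : IsGroupLikeElem k g) :
    ∃ x y : P, x * y = 1 ∧ y * x = 1 ∧ ∀ χ : H →ₐ[k] k,
      evalRight P χ (ρ.coact x) = χ (π g) • x := by
  let κ := evalRight P (Bialgebra.counitAlgHom k V)
  obtain ⟨⟨j₁, j₂, h12, h21⟩, rfl : j₁ = WithConv.toConv j⟩ := hj.convInvertible
  -- At a group-like element convolution is pointwise multiplication.
  have conv (f f' : WithConv (V →ₗ[k] prolongationSubalgebra ρ π)) (h : f * f' = 1) :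
      f.ofConv g * f'.ofConv g = 1 := by
    have := congrArg (fun F : WithConv (V →ₗ[k] prolongationSubalgebra ρ π) => F.ofConv g) h
    simpa [LinearMap.convMul_apply, hg.comul_eq_tmul_self, hg.counit_eq_one] using this
  let ξ : P ⊗[k] V := j g
  have hξ : ξ = κ ξ ⊗ₜ g := by
    have h1 := LinearMap.congr_fun hj.colinear g
    simp only [LinearMap.comp_apply, hg.comul_eq_tmul_self, LinearMap.rTensor_tmul] at h1
    have h2 : tensorCoact k P V ξ = ξ ⊗ₜ g := by
      rw [← prolongationIncl_coact ρ π (j g)]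
      exact (congrArg (prolongationIncl ρ π) h1).trans rfl
    have h3 := evalRight_counit_tensorCoact ξ
    rw [h2, LinearMap.rTensor_tmul] at h3
    exact h3.symm
  refine ⟨κ ξ, κ (j₂.ofConv g : prolongationSubalgebra ρ π), ?_, ?_, fun χ => ?_⟩
  · rw [← map_mul, ← map_one κ]
    exact congrArg (fun z : prolongationSubalgebra ρ π => κ z) (conv _ _ h12)
  · rw [← map_mul, ← map_one κ]
    exact congrArg (fun z : prolongationSubalgebra ρ π => κ z) (conv _ _ h21)
  · have hmem : TensorProduct.assoc k P H V (ρ.coact.toLinearMap.rTensor V ξ) =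
        (leftCoact π).toLinearMap.lTensor P ξ := (j g).2
    rw [hξ] at hmem
    -- The map `id ⊗ χ ⊗ ε` turns the cotensor condition for `κ ξ ⊗ g` into an eigenvector equation
    -- in `P`.
    let Φ := evalRight P (Algebra.TensorProduct.lift χ (Bialgebra.counitAlgHom k V)
      fun _ _ => Commute.all _ _)
    have hΦ (t : P ⊗[k] H) : Φ (TensorProduct.assoc k P H V (t ⊗ₜ g)) = evalRight P χ t := by
      induction t using TensorProduct.induction_on with
      | zero => simp
      | add x y hx hy => simp only [TensorProduct.add_tmul, map_add, hx, hy]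
      | tmul p h => simp [Φ, evalRight_tmul, hg.counit_eq_one]
    have := congrArg Φ hmem
    simp only [LinearMap.rTensor_tmul, LinearMap.lTensor_tmul, AlgHom.toLinearMap_apply, hΦ] at this
    rw [this]
    simp [Φ, evalRight_tmul, leftCoact, hg.comul_eq_tmul_self, hg.counit_eq_one]

end Prolongation

end HeegaardSphere

/-- For `0 ≤ p, q, θ < 1` with `θ` irrational and `N ≥ 2`, the `O(U(1))`-comodule algebra
`O(S³_{pqθ}) □_{O(ℤ/Nℤ)} O(U(1))` is not cleft. -/
theorem mainTheorem7 (p q θ : ℝ) (hp : 0 ≤ p ∧ p < 1) (hq : 0 ≤ q ∧ q < 1)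
    (hθ : 0 ≤ θ ∧ θ < 1) (hirr : Irrational θ) (N : ℕ) (hN : 2 ≤ N) :
    ¬ (HeegaardSphere.sphereProlongation p q θ N).IsCleft := by
  open HeegaardSphere in
  rintro ⟨j, hj⟩
  obtain ⟨x, y, hxy, hyx, hx⟩ := exists_unit_of_isCleavingMap _ _ hj
    (g := (LaurentPolynomial.T 1 : OU1)) ⟨by simp, by simp⟩
  have : NeZero N := ⟨by omega⟩
  have : Fact (1 < N) := ⟨by omega⟩
  -- This character sends `ũ` to the primitive root of unity `exp(2πi/N)`; faithfulness of the
  -- standard character on `ZMod N` gives the final contradiction.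
  let χ : OZMod N →ₐ[ℂ] ℂ := AddMonoidAlgebra.lift ℂ ℂ (ZMod N) ZMod.stdAddChar.toMonoidHom
  have hχ (a : ZMod N) : χ (AddMonoidAlgebra.single a 1) = ZMod.stdAddChar a := by simp [χ]
  have hχT (n : ℤ) : χ (projZMod N (LaurentPolynomial.T n)) = ZMod.stdAddChar (1 : ZMod N) ^ n := by
    rw [projZMod_T, hχ, ← AddChar.map_zsmul_eq_zpow, zsmul_one]
  have hζ := hx χ
  rw [hχT, zpow_one] at hζ
  have h1 : ZMod.stdAddChar (1 : ZMod N) = 1 := by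
    refine eq_one_of_unit_of_scaling hp hq (AddChar.val_isUnit ZMod.stdAddChar (1 : ZMod N)).ne_zero
      (α := (evalRight _ χ).comp (sphereZMod p q θ N).coact) (fun g => ?_) hxy hyx hζ
    have : (sphereZMod p q θ N).coact (gen p q θ g) =
        gen p q θ g ⊗ₜ projZMod N (LaurentPolynomial.T g.deg) := by
      change Algebra.TensorProduct.map (AlgHom.id ℂ _) (projZMod N : OU1 →ₐ[ℂ] OZMod N)
        (sphereCoact p q θ (gen p q θ g)) = _
      rw [sphereCoact_gen]
      rfl
    rw [AlgHom.comp_apply, this, evalRight_tmul, hχT]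
  rw [← AddChar.map_zero_eq_one (ZMod.stdAddChar (N := N))] at h1
  exact one_ne_zero (ZMod.injective_stdAddChar h1)
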